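/- Let $n\ge 2$ be an integer and $C\in\mathbb R$. For a simple graph $A$ on $\{1,\dots,n\}$ (identified with its adjacency matrix) and a real $n\times n$ matrix $M$ put $$L_A(M)=\sum_{i\ne j}\bigl[A_{ij}\log M_{ij}+(1-A_{ij})\log(1-M_{ij})\bigr],$$ the sum being over ordered pairs. Let $\mathcal F_n$ be the set of real symmetric positive semidefinite $n\times n$ matrices $M$ with $\frac1n\le M_{ij}\le 1-\frac1n$ for all $i\ne j$, and let REG-MOD be the program of maximizing $L_A(M)-C\operatorname{tr}M$ over $M\in\mathcal F_n$. For $X,Y\in\mathcal F_n$ let $$D(X\|Y)=-\frac1{n(n-1)}\sum_{i\ne j}\Bigl[X_{ij}\log\frac{Y_{ij}}{X_{ij}}+(1-X_{ij})\log\frac{1-Y_{ij}}{1-X_{ij}}\Bigr],$$ and let $H[P]=-\sum_{i\ne j}P_{ij}\log P_{ij}$. **Theorem.** There is an absolute constant $K>0$ such that the following holds for all $n\ge2$, all $C\in\mathbb R$, all $P\in\mathcal F_n$ and all $\delta>0$. Let $A$ be the random simple graph on $\{1,\dots,n\}$ with $\mathbb P[A]=\prod_{i<j}P_{ij}^{A_{ij}}(1-P_{ij})^{1-A_{ij}}$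 (independent edges, $i\sim j$ with probability $P_{ij}$), and let $P^*=P^*_A$ be, for every graph $A$, an optimal solution of REG-MOD for $A$. Then, with probability at least $1-\delta$, $$D(P\|P^*)\le \frac{K\,\mathbb E[\operatorname{tr}P^*]\log n}{\delta\sqrt n}+\frac{C\operatorname{tr}P-C\operatorname{tr}P^*}{n(n-1)}-\frac{L_A(P)+H[P]}{n(n-1)},$$ and on the same event the inequality also holds with $H[P]$ replaced by the full Bernoulli entropy $-\sum_{i\ne j}\bigl[P_{ij}\log P_{ij}+(1-P_{ij})\log(1-P_{ij})\bigr]$. -/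

import Mathlib

open MeasureTheory

noncomputable section

namespace RDPG

variable {n : ℕ}

/-- The mass function of the random graph with edge-probability matrix `P`: the edges `{i, j}`,
`i < j`, are present independently, with probability `P i j`. -/
def graphMass (P : Matrix (Fin n) (Fin n) ℝ) (G : SimpleGraph (Fin n)) : ℝ :=
  open Classical in
  ∏ p : Fin n × Fin n with p.1 < p.2, if G.Adj p.1 p.2 then P p.1 p.2 else 1 - P p.1 p.2

/-- The law of the random graph with edge-probability matrix `P`. -/
def graphLaw (P : Matrix (Fin n) (Fin n) ℝ) : Measure (SimpleGraph (Fin n)) :=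
  Measure.sum fun G => ENNReal.ofReal (graphMass P G) • Measure.dirac G

/-- The Bernoulli log likelihood `L_A(M)` of the graph `G` with adjacency matrix `A`, summed over
all ordered pairs of distinct vertices:
`A i j * log (M i j) + (1 - A i j) * log (1 - M i j)`. -/
def logLik (G : SimpleGraph (Fin n)) (M : Matrix (Fin n) (Fin n) ℝ) : ℝ :=
  open Classical in
  ∑ p ∈ (Finset.univ : Finset (Fin n)).offDiag,
    if G.Adj p.1 p.2 then Real.log (M p.1 p.2) else Real.log (1 - M p.1 p.2)

/-- The trace-regularized objective `L_A(M) - C tr M`. -/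
def regLogLik (C : ℝ) (G : SimpleGraph (Fin n)) (M : Matrix (Fin n) (Fin n) ℝ) : ℝ :=
  logLik G M - C * M.trace

/-- The feasible set of the modified program: positive semidefinite (in particular symmetric)
matrices whose off-diagonal entries lie in `[1/n, 1 - 1/n]`. The diagonal is not constrained
further. -/
def feasible (n : ℕ) : Set (Matrix (Fin n) (Fin n) ℝ) :=
  {M | M.PosSemidef ∧ ∀ i j, i ≠ j → 1 / (n : ℝ) ≤ M i j ∧ M i j ≤ 1 - 1 / (n : ℝ)}

/-- `M` is an optimal solution of the modified program for the observed graph `G`. -/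
def IsOptimal (C : ℝ) (G : SimpleGraph (Fin n)) (M : Matrix (Fin n) (Fin n) ℝ) : Prop :=
  M ∈ feasible n ∧ ∀ N ∈ feasible n, regLogLik C G N ≤ regLogLik C G M

/-- The matrix KL divergence: the mean off-diagonal entrywise Bernoulli divergence. -/
def klDiv (X Y : Matrix (Fin n) (Fin n) ℝ) : ℝ :=
  -(1 / ((n : ℝ) * (n - 1))) * ∑ p ∈ (Finset.univ : Finset (Fin n)).offDiag,
    (X p.1 p.2 * Real.log (Y p.1 p.2 / X p.1 p.2)
      + (1 - X p.1 p.2) * Real.log ((1 - Y p.1 p.2) / (1 - X p.1 p.2)))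

/-- The entropy `H[P]` of the edge-probability matrix, `-∑ P i j * log (P i j)` over `i ≠ j`. -/
def entropy (P : Matrix (Fin n) (Fin n) ℝ) : ℝ :=
  -∑ p ∈ (Finset.univ : Finset (Fin n)).offDiag, P p.1 p.2 * Real.log (P p.1 p.2)

/-- The full Bernoulli entropy of the edge-probability matrix, which also counts the non-edges. -/
def bernoulliEntropy (P : Matrix (Fin n) (Fin n) ℝ) : ℝ :=
  -∑ p ∈ (Finset.univ : Finset (Fin n)).offDiag,
    (P p.1 p.2 * Real.log (P p.1 p.2) + (1 - P p.1 p.2) * Real.log (1 - P p.1 p.2))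

/-- The right-hand side of the bound, for an entropy term `H`. Here `T` is the expected trace of
the estimator, `G` the observed graph and `M` its estimate. -/
def klBound (K C δ T H : ℝ) (G : SimpleGraph (Fin n)) (P M : Matrix (Fin n) (Fin n) ℝ) : ℝ :=
  K * T * Real.log n / (δ * √n) + (C * P.trace - C * M.trace) / ((n : ℝ) * (n - 1))
    - (logLik G P + H) / ((n : ℝ) * (n - 1))

end RDPG

end

/-!
Since `P` is feasible, optimality of `P*` reduces the bound to one on the deviation `noise` of the
log likelihood at `P*` from its mean (`klDiv_eq`, `klDiv_le_klBound`), and by Markov's inequality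
it is enough that the expected positive part of this deviation is `O(n √n log n) * 𝔼 tr P*`
(`bernoulliAvg_max_noise_le`).

The deviation is `∑ i ≠ j, (A i j - P i j) * logit (M i j)` at `M = P*`, where `M` depends on `A`,
and the logit is `2 n`-Lipschitz on `[1/n, 1 - 1/n]`. A coordinatewise symmetrization and
contraction argument (`bernoulliAvg_contraction`) replaces `A i j - P i j` by random signs `ε i j`
and the logit by `2 n * M i j`. It admits an arbitrary additive functional of `M`, and so a penalty
`-Λ * tr M`, which is what makes a random trace harmless. As `M` is positive semidefinite,
`∑ i ≠ j, ε i j * M i j` is at most `tr M` times the largest value of the form of `ε` on unit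
vectors, and that is `O(√n log n)` up to an excess with expectation at most `1 / √n`: this follows
from a union bound over a grid of mesh `1 / n` (`signForm_le`, `bernoulliAvg_netExcess_le`). Hence
`Λ = 62 n √n log n` absorbs the linear process up to `2 n`. This excess is multiplied by `tr M`, so
the argument is run for `tr M ≤ √n`; for larger traces the trivial bound `n ^ 2 log n` on the
deviation is already below `Λ * tr M`. All remaining terms are absorbed by `tr M ≥ 1`.
-/

namespace RDPG

/-! ### Averages over independent coin flips -/

/-- The expectation of `f s`, where `s` is the random subset of `E` that contains each `e ∈ E`
independently with probability `p e`. -/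
noncomputable def bernoulliAvg {ι : Type*} [DecidableEq ι] (p : ι → ℝ) (E : Finset ι)
    (f : Finset ι → ℝ) : ℝ :=
  ∑ s ∈ E.powerset, (∏ e ∈ E, if e ∈ s then p e else 1 - p e) * f s

section bernoulliAvg

variable {ι T : Type*} [DecidableEq ι] {p : ι → ℝ} {E : Finset ι} {f g : Finset ι → ℝ}

lemma bernoulliAvg_empty : bernoulliAvg p ∅ f = f ∅ := by
  simp [bernoulliAvg]

lemma bernoulliAvg_insert {a : ι} (ha : a ∉ E) :
    bernoulliAvg p (insert a E) f
      = bernoulliAvg p E fun s => p a * f (insert a s) + (1 - p a) * f s := by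
  unfold bernoulliAvg
  rw [Finset.sum_powerset_insert ha, ← Finset.sum_add_distrib]
  refine Finset.sum_congr rfl fun s hs => ?_
  have has : a ∉ s := fun h => ha (Finset.mem_powerset.1 hs h)
  rw [Finset.prod_insert ha, Finset.prod_insert ha, if_neg has,
    if_pos (Finset.mem_insert_self a s)]
  have : ∏ e ∈ E, (if e ∈ insert a s then p e else 1 - p e)
      = ∏ e ∈ E, (if e ∈ s then p e else 1 - p e) := by
    refine Finset.prod_congr rfl fun e he => ?_
    have : e ≠ a := fun h => ha (h ▸ he)
    simp [this]
  rw [this]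
  ring

lemma bernoulliAvg_congr (h : ∀ s ⊆ E, f s = g s) :
    bernoulliAvg p E f = bernoulliAvg p E g :=
  Finset.sum_congr rfl fun s hs => by rw [h s (Finset.mem_powerset.1 hs)]

lemma bernoulliAvg_add :
    bernoulliAvg p E (fun s => f s + g s) = bernoulliAvg p E f + bernoulliAvg p E g := by
  simp [bernoulliAvg, mul_add, Finset.sum_add_distrib]

lemma bernoulliAvg_const_mul (c : ℝ) :
    bernoulliAvg p E (fun s => c * f s) = c * bernoulliAvg p E f := by
  simp only [bernoulliAvg, Finset.mul_sum]
  exact Finset.sum_congr rfl fun s _ => by ring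

lemma bernoulliAvg_sum {κ : Type*} (N : Finset κ) (F : κ → Finset ι → ℝ) :
    bernoulliAvg p E (fun s => ∑ k ∈ N, F k s) = ∑ k ∈ N, bernoulliAvg p E (F k) := by
  simp only [bernoulliAvg, Finset.mul_sum]
  exact Finset.sum_comm

lemma bernoulliAvg_const (c : ℝ) : bernoulliAvg p E (fun _ => c) = c := by
  induction E using Finset.induction_on with
  | empty => exact bernoulliAvg_empty
  | insert a E ha ih =>
    rw [bernoulliAvg_insert ha]
    refine (bernoulliAvg_congr fun s _ => ?_).trans ih
    ring

lemma bernoulliAvg_mono (hp : ∀ e ∈ E, 0 ≤ p e ∧ p e ≤ 1) (h : ∀ s ⊆ E, f s ≤ g s) :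
    bernoulliAvg p E f ≤ bernoulliAvg p E g := by
  refine Finset.sum_le_sum fun s hs =>
    mul_le_mul_of_nonneg_left (h s (Finset.mem_powerset.1 hs)) ?_
  refine Finset.prod_nonneg fun e he => ?_
  split_ifs
  · exact (hp e he).1
  · linarith [(hp e he).2]

/-- The second moment of a shifted sum of independent centred Bernoulli variables. -/
lemma bernoulliAvg_sq (c : ℝ) (v : ι → ℝ) :
    bernoulliAvg p E (fun s => (c + ∑ e ∈ E, ((if e ∈ s then 1 else 0) - p e) * v e) ^ 2)
      = c ^ 2 + ∑ e ∈ E, p e * (1 - p e) * v e ^ 2 := by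
  induction E using Finset.induction_on generalizing c with
  | empty => simp [bernoulliAvg_empty]
  | insert a E ha ih =>
    rw [bernoulliAvg_insert ha, Finset.sum_insert ha]
    have key : ∀ s ⊆ E,
        p a * (c + ∑ e ∈ insert a E, ((if e ∈ insert a s then 1 else 0) - p e) * v e) ^ 2
          + (1 - p a) * (c + ∑ e ∈ insert a E, ((if e ∈ s then 1 else 0) - p e) * v e) ^ 2
        = (c + ∑ e ∈ E, ((if e ∈ s then 1 else 0) - p e) * v e) ^ 2
          + p a * (1 - p a) * v a ^ 2 := by
      intro s hs
      have has : a ∉ s := fun h => ha (hs h)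
      rw [Finset.sum_insert ha, Finset.sum_insert ha, if_neg has,
        if_pos (Finset.mem_insert_self a s)]
      have : ∑ e ∈ E, ((if e ∈ insert a s then 1 else 0) - p e) * v e
          = ∑ e ∈ E, ((if e ∈ s then 1 else 0) - p e) * v e := by
        refine Finset.sum_congr rfl fun e he => ?_
        have : e ≠ a := fun h => ha (h ▸ he)
        simp [this]
      rw [this]
      ring
    rw [bernoulliAvg_congr key, bernoulliAvg_add, ih, bernoulliAvg_const]
    ring

/-- Subgaussian bound for the moment generating function of a weighted sum of random signs. -/
lemma bernoulliAvg_exp_le (v : ι → ℝ) :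
    bernoulliAvg (fun _ => 1 / 2) E
        (fun s => Real.exp (∑ e ∈ E, (if e ∈ s then 1 else -1) * v e))
      ≤ Real.exp (∑ e ∈ E, v e ^ 2 / 2) := by
  induction E using Finset.induction_on with
  | empty => simp [bernoulliAvg_empty]
  | insert a E ha ih =>
    rw [bernoulliAvg_insert ha, Finset.sum_insert ha]
    have key : ∀ s ⊆ E,
        1 / 2 * Real.exp (∑ e ∈ insert a E, (if e ∈ insert a s then 1 else -1) * v e)
          + (1 - 1 / 2) * Real.exp (∑ e ∈ insert a E, (if e ∈ s then 1 else -1) * v e)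
        = Real.cosh (v a) * Real.exp (∑ e ∈ E, (if e ∈ s then 1 else -1) * v e) := by
      intro s hs
      have has : a ∉ s := fun h => ha (hs h)
      rw [Finset.sum_insert ha, Finset.sum_insert ha, if_neg has,
        if_pos (Finset.mem_insert_self a s)]
      have : ∑ e ∈ E, (if e ∈ insert a s then 1 else -1) * v e
          = ∑ e ∈ E, (if e ∈ s then 1 else -1) * v e := by
        refine Finset.sum_congr rfl fun e he => ?_
        have : e ≠ a := fun h => ha (h ▸ he)
        simp [this]
      rw [this, one_mul, neg_one_mul, Real.exp_add, Real.exp_add, Real.cosh_eq]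
      ring
    rw [bernoulliAvg_congr key, bernoulliAvg_const_mul, Real.exp_add]
    exact mul_le_mul (Real.cosh_le_exp_half_sq _) ih
      (by
        unfold bernoulliAvg
        refine Finset.sum_nonneg fun s _ => mul_nonneg (Finset.prod_nonneg fun e _ => ?_)
          (Real.exp_pos _).le
        split_ifs <;> norm_num)
      (Real.exp_pos _).le

/-- One step of the contraction principle: a centred Bernoulli variable multiplying `ψ` is replaced
by a random sign multiplying `τ`, where `τ` moves at least as much as `ψ`. The pair `(a', b')` can
be found among `(a, a)`, `(b, b)`, `(a, b)`, `(b, a)`. -/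
lemma exists_pair_contraction {q : ℝ} (h0 : 0 ≤ q) (h1 : q ≤ 1) (G ψ τ : T → ℝ) (a b : T)
    (h : |ψ a - ψ b| ≤ |τ a - τ b|) :
    ∃ a' b', q * (G a + (1 - q) * ψ a) + (1 - q) * (G b - q * ψ b)
      ≤ 1 / 2 * (G a' + τ a') + 1 / 2 * (G b' - τ b') := by
  by_contra! H
  set u := q * (G a + (1 - q) * ψ a) + (1 - q) * (G b - q * ψ b) with hu
  have haa := H a a
  have hbb := H b b
  have hab : G a + G b + |τ a - τ b| < 2 * u := by
    have h1 := H a b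
    have h2 := H b a
    rcases abs_cases (τ a - τ b) with h | h <;> linarith
  have hψ : ψ a - ψ b ≤ |τ a - τ b| := (le_abs_self _).trans h
  set t := |τ a - τ b|
  have ht : 0 ≤ t := abs_nonneg _
  -- `u` is at most a convex combination of `G a`, `G b` and `(G a + G b + t) / 2`, all of which
  -- are less than `u`; `m` is the smallest gap.
  obtain ⟨m, hm, hma, hmb, hmab⟩ : ∃ m, 0 < m ∧ m ≤ u - G a ∧ m ≤ u - G b ∧
      2 * m ≤ 2 * u - (G a + G b + t) := by
    refine ⟨min (u - G a) (min (u - G b) ((2 * u - (G a + G b + t)) / 2)), ?_, ?_, ?_, ?_⟩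
    · refine lt_min ?_ (lt_min ?_ ?_) <;> linarith
    · exact min_le_left _ _
    · exact (min_le_right _ _).trans (min_le_left _ _)
    · have := (min_le_right (u - G a) (min (u - G b) ((2 * u - (G a + G b + t)) / 2))).trans
        (min_le_right _ _)
      linarith
  have hq : 0 ≤ q * (1 - q) := mul_nonneg h0 (by linarith)
  have hmul : q * (1 - q) * (ψ a - ψ b) ≤ q * (1 - q) * t := mul_le_mul_of_nonneg_left hψ hq
  rcases le_total q (1 / 2) with hq2 | hq2
  · have e1 : 0 ≤ (1 - 2 * q) * (u - G b - m) := mul_nonneg (by linarith) (by linarith)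
    have e2 : 0 ≤ q * (2 * u - (G a + G b + t) - 2 * m) := mul_nonneg h0 (by linarith)
    have e3 : 0 ≤ q * q * t := by positivity
    nlinarith
  · have e1 : 0 ≤ (2 * q - 1) * (u - G a - m) := mul_nonneg (by linarith) (by linarith)
    have e2 : 0 ≤ (1 - q) * (2 * u - (G a + G b + t) - 2 * m) :=
      mul_nonneg (by linarith) (by linarith)
    have e3 : 0 ≤ (1 - q) * (1 - q) * t := by positivity
    nlinarith

/-- Symmetrization and contraction in one step, for processes indexed by an arbitrary type `T`.
In place of the suprema over `T` stand selections `x`, `y`, which depend on the outcome: the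
expectation along any selection `x` of the Bernoulli process is dominated by the expectation along
some selection `y` of the sign process. -/
theorem bernoulliAvg_contraction (hp : ∀ e ∈ E, 0 ≤ p e ∧ p e ≤ 1) (ψ τ : ι → T → ℝ)
    (h : ∀ e ∈ E, ∀ x y, |ψ e x - ψ e y| ≤ |τ e x - τ e y|) (g : T → ℝ) (x : Finset ι → T) :
    ∃ y : Finset ι → T,
      bernoulliAvg p E
          (fun s => g (x s) + ∑ e ∈ E, ((if e ∈ s then 1 else 0) - p e) * ψ e (x s))
        ≤ bernoulliAvg (fun _ => 1 / 2) E
          (fun s => g (y s) + ∑ e ∈ E, (if e ∈ s then 1 else -1) * τ e (y s)) := by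
  induction E using Finset.induction_on generalizing g x with
  | empty => exact ⟨x, by simp [bernoulliAvg_empty]⟩
  | insert a E ha ih =>
    have hpa := hp a (Finset.mem_insert_self a E)
    have hpE : ∀ e ∈ E, 0 ≤ p e ∧ p e ≤ 1 := fun e he => hp e (Finset.mem_insert_of_mem he)
    replace ih := ih hpE fun e he => h e (Finset.mem_insert_of_mem he)
    choose x₁ x₂ hx using fun s : Finset ι => exists_pair_contraction hpa.1 hpa.2
      (fun t => g t + ∑ e ∈ E, ((if e ∈ s then 1 else 0) - p e) * ψ e t) (ψ a) (τ a)
      (x (insert a s)) (x s) (h a (Finset.mem_insert_self a E) _ _)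
    obtain ⟨y₁, hy₁⟩ := ih (fun t => g t + τ a t) x₁
    obtain ⟨y₂, hy₂⟩ := ih (fun t => g t - τ a t) x₂
    refine ⟨fun s => if a ∈ s then y₁ (s.erase a) else y₂ s, ?_⟩
    rw [bernoulliAvg_insert ha, bernoulliAvg_insert ha]
    have hne : ∀ {e}, e ∈ E → e ≠ a := fun he h => ha (h ▸ he)
    calc
      _ ≤ bernoulliAvg p E fun s =>
            1 / 2 * ((g (x₁ s) + τ a (x₁ s))
              + ∑ e ∈ E, ((if e ∈ s then 1 else 0) - p e) * ψ e (x₁ s))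
            + 1 / 2 * ((g (x₂ s) - τ a (x₂ s))
              + ∑ e ∈ E, ((if e ∈ s then 1 else 0) - p e) * ψ e (x₂ s)) := by
        refine bernoulliAvg_mono hpE fun s hs => ?_
        have has : a ∉ s := fun h => ha (hs h)
        rw [Finset.sum_insert ha, Finset.sum_insert ha, if_neg has,
          if_pos (Finset.mem_insert_self a s)]
        have : ∑ e ∈ E, ((if e ∈ insert a s then 1 else 0) - p e) * ψ e (x (insert a s))
            = ∑ e ∈ E, ((if e ∈ s then 1 else 0) - p e) * ψ e (x (insert a s)) :=
          Finset.sum_congr rfl fun e he => by simp [hne he]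
        rw [this]
        have := hx s
        linarith
      _ ≤ bernoulliAvg (fun _ => 1 / 2) E fun s =>
            1 / 2 * ((g (y₁ s) + τ a (y₁ s))
              + ∑ e ∈ E, (if e ∈ s then 1 else -1) * τ e (y₁ s))
            + 1 / 2 * ((g (y₂ s) - τ a (y₂ s))
              + ∑ e ∈ E, (if e ∈ s then 1 else -1) * τ e (y₂ s)) := by
        have lin : ∀ (q : ι → ℝ) (f₁ f₂ : Finset ι → ℝ),
            bernoulliAvg q E (fun s => 1 / 2 * f₁ s + 1 / 2 * f₂ s)
              = 1 / 2 * bernoulliAvg q E f₁ + 1 / 2 * bernoulliAvg q E f₂ := fun q f₁ f₂ => by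
          rw [bernoulliAvg_add, bernoulliAvg_const_mul, bernoulliAvg_const_mul]
        rw [lin, lin]
        linarith
      _ = _ := by
        refine bernoulliAvg_congr fun s hs => ?_
        have has : a ∉ s := fun h => ha (hs h)
        rw [Finset.sum_insert ha, Finset.sum_insert ha]
        have : ∀ z, ∑ e ∈ E, (if e ∈ insert a s then 1 else -1) * τ e z
            = ∑ e ∈ E, (if e ∈ s then 1 else -1) * τ e z := fun z =>
          Finset.sum_congr rfl fun e he => by simp [hne he]
        simp only [this, Finset.mem_insert_self, if_true, if_neg has, Finset.erase_insert has]
        ring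

end bernoulliAvg

/-! ### Quadratic forms with random signs -/

/-- The pairs `(i, j)` with `i < j`, which index the potential edges of a graph on `Fin n`. -/
def upperPairs (n : ℕ) : Finset (Fin n × Fin n) := {p | p.1 < p.2}

lemma mem_upperPairs {n : ℕ} {p : Fin n × Fin n} : p ∈ upperPairs n ↔ p.1 < p.2 := by
  simp [upperPairs]

lemma sum_offDiag_eq_sum_upperPairs {n : ℕ} (f : Fin n × Fin n → ℝ) :
    ∑ p ∈ (Finset.univ : Finset (Fin n)).offDiag, f p
      = ∑ p ∈ upperPairs n, (f p + f p.swap) := by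
  rw [← Finset.sum_filter_add_sum_filter_not _ (fun p : Fin n × Fin n => p.1 < p.2),
    Finset.sum_add_distrib]
  congr 1
  · refine Finset.sum_congr ?_ fun _ _ => rfl
    ext p
    simp only [Finset.mem_filter, Finset.mem_offDiag, Finset.mem_univ, true_and, mem_upperPairs]
    exact ⟨fun h => h.2, fun h => ⟨h.ne, h⟩⟩
  · refine Finset.sum_nbij' Prod.swap Prod.swap ?_ ?_ ?_ ?_ ?_
    · intro p hp
      simp only [Finset.mem_filter, Finset.mem_offDiag, Finset.mem_univ, true_and, not_lt] at hp
      exact mem_upperPairs.2 (lt_of_le_of_ne hp.2 fun h => hp.1 h.symm)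
    · intro p hp
      have := mem_upperPairs.1 hp
      simp only [Finset.mem_filter, Finset.mem_offDiag, Finset.mem_univ, true_and, not_lt,
        Prod.fst_swap, Prod.snd_swap]
      exact ⟨this.ne', this.le⟩
    all_goals simp

lemma sum_offDiag_le_sum_sum {n : ℕ} (f : Fin n × Fin n → ℝ) (hf : ∀ p, 0 ≤ f p) :
    ∑ p ∈ (Finset.univ : Finset (Fin n)).offDiag, f p ≤ ∑ i, ∑ j, f (i, j) := by
  rw [← Finset.sum_product', Finset.univ_product_univ]
  exact Finset.sum_le_univ_sum_of_nonneg hf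

/-- The quadratic form `∑ i ≠ j, ε i j * x i * x j` of the symmetric sign matrix `ε` with zero
diagonal whose entry at `i < j` is `1` if `(i, j) ∈ s` and `-1` otherwise. -/
noncomputable def signForm {n : ℕ} (s : Finset (Fin n × Fin n)) (x : Fin n → ℝ) : ℝ :=
  ∑ e ∈ upperPairs n, (if e ∈ s then 1 else -1) * (2 * (x e.1 * x e.2))

/-- Integer vectors `z` such that the points `z / n` come within `1 / n`, in every coordinate, of
every unit vector. -/
noncomputable def gridNet (n : ℕ) : Finset (Fin n → ℤ) :=
  {z ∈ Fintype.piFinset fun _ => Finset.Icc (-(n : ℤ)) n | ∑ i, ((z i : ℝ) / n) ^ 2 ≤ 4}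

lemma card_gridNet_le {n : ℕ} (hn : 2 ≤ n) :
    ((gridNet n).card : ℝ) ≤ Real.exp (n * (3 * Real.log n)) := by
  have h1 : (gridNet n).card ≤ (2 * n + 1) ^ n := by
    refine (Finset.card_filter_le _ _).trans ?_
    rw [Fintype.card_piFinset]
    simp only [Int.card_Icc, Finset.prod_const, Finset.card_univ, Fintype.card_fin]
    exact Nat.pow_le_pow_left (by omega) _
  have h2 : (2 * n + 1) ^ n ≤ (n ^ 3) ^ n := by
    refine Nat.pow_le_pow_left ?_ _
    have : 4 * n ≤ n ^ 3 := by nlinarith [Nat.mul_le_mul hn hn]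
    omega
  have hn0 : (0 : ℝ) < n := by exact_mod_cast (by omega : 0 < n)
  rw [Real.exp_nat_mul, mul_comm, Real.exp_mul, Real.exp_log hn0]
  exact_mod_cast h1.trans h2

/-- A sum of exponentials that controls the maximum of `signForm s` over the net. -/
noncomputable def netExcess {n : ℕ} (s : Finset (Fin n × Fin n)) : ℝ :=
  ∑ z ∈ gridNet n,
    Real.exp (√n * (signForm s (fun i => (z i : ℝ) / n) - √n * (3 * Real.log n + 16)))

lemma netExcess_nonneg {n : ℕ} (s : Finset (Fin n × Fin n)) : 0 ≤ netExcess s :=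
  Finset.sum_nonneg fun _ _ => (Real.exp_pos _).le

lemma sum_upperPairs_sq_le {n : ℕ} (x : Fin n → ℝ) :
    ∑ e ∈ upperPairs n, 2 * (x e.1 * x e.2) ^ 2 ≤ (∑ i, x i ^ 2) ^ 2 := by
  have h := sum_offDiag_eq_sum_upperPairs (n := n) fun e => (x e.1 * x e.2) ^ 2
  have h2 := sum_offDiag_le_sum_sum (n := n) (fun e => (x e.1 * x e.2) ^ 2)
    fun _ => sq_nonneg _
  rw [h] at h2
  calc _ = ∑ p ∈ upperPairs n, ((x p.1 * x p.2) ^ 2 + (x p.swap.1 * x p.swap.2) ^ 2) :=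
        Finset.sum_congr rfl fun p _ => by simp only [Prod.fst_swap, Prod.snd_swap]; ring
    _ ≤ _ := h2
    _ = _ := by
      rw [sq (∑ i, x i ^ 2), Finset.sum_mul_sum]
      exact Finset.sum_congr rfl fun i _ => Finset.sum_congr rfl fun j _ => by ring

/-- The union bound over the net: its `exp (3 n log n)` points are outweighed by the subgaussian
tail of each value of the form. -/
lemma bernoulliAvg_netExcess_le {n : ℕ} (hn : 2 ≤ n) :
    bernoulliAvg (fun _ => 1 / 2) (upperPairs n) netExcess ≤ 1 := by
  have hn0 : (0 : ℝ) ≤ n := Nat.cast_nonneg n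
  have hs : √(n : ℝ) * √n = n := Real.mul_self_sqrt hn0
  unfold netExcess
  rw [bernoulliAvg_sum]
  have key : ∀ z ∈ gridNet n, bernoulliAvg (fun _ => 1 / 2) (upperPairs n) (fun s =>
      Real.exp (√n * (signForm s (fun i => (z i : ℝ) / n) - √n * (3 * Real.log n + 16))))
      ≤ Real.exp (-(n * (3 * Real.log n))) := by
    intro z hz
    set x : Fin n → ℝ := fun i => (z i : ℝ) / n with hx
    have hx4 : ∑ i, x i ^ 2 ≤ 4 := (Finset.mem_filter.1 hz).2
    have h1 : ∀ s, Real.exp (√n * (signForm s x - √n * (3 * Real.log n + 16)))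
        = Real.exp (-(n * (3 * Real.log n + 16)))
          * Real.exp (∑ e ∈ upperPairs n,
              (if e ∈ s then 1 else -1) * (√n * (2 * (x e.1 * x e.2)))) := by
      intro s
      rw [← Real.exp_add]
      congr 1
      have : ∑ e ∈ upperPairs n, (if e ∈ s then 1 else -1) * (√n * (2 * (x e.1 * x e.2)))
          = √n * signForm s x := by
        rw [signForm, Finset.mul_sum]
        exact Finset.sum_congr rfl fun e _ => by ring
      rw [this]
      linear_combination (-(3 * Real.log n + 16)) * hs
    simp only [h1]
    rw [bernoulliAvg_const_mul]
    have h2 := bernoulliAvg_exp_le (E := upperPairs n) fun e => √n * (2 * (x e.1 * x e.2))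
    have h3 : ∑ e ∈ upperPairs n, (√n * (2 * (x e.1 * x e.2))) ^ 2 / 2 ≤ (n : ℝ) * 16 := by
      calc _ = (n : ℝ) * ∑ e ∈ upperPairs n, 2 * (x e.1 * x e.2) ^ 2 := by
            rw [Finset.mul_sum]
            exact Finset.sum_congr rfl fun e _ => by
              linear_combination (2 * (x e.1 * x e.2) ^ 2) * hs
        _ ≤ n * 16 := by
            refine mul_le_mul_of_nonneg_left ((sum_upperPairs_sq_le x).trans ?_) hn0
            have : 0 ≤ ∑ i, x i ^ 2 := Finset.sum_nonneg fun _ _ => sq_nonneg _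
            nlinarith
    calc _ ≤ Real.exp (-(n * (3 * Real.log n + 16))) * Real.exp (n * 16) :=
          mul_le_mul_of_nonneg_left (h2.trans (Real.exp_le_exp.2 h3)) (Real.exp_pos _).le
      _ = _ := by rw [← Real.exp_add]; congr 1; ring
  calc _ ≤ ∑ z ∈ gridNet n, Real.exp (-(n * (3 * Real.log n))) := Finset.sum_le_sum key
    _ = (gridNet n).card * Real.exp (-(n * (3 * Real.log n))) := by
      rw [Finset.sum_const, nsmul_eq_mul]
    _ ≤ Real.exp (n * (3 * Real.log n)) * Real.exp (-(n * (3 * Real.log n))) :=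
      mul_le_mul_of_nonneg_right (card_gridNet_le hn) (Real.exp_pos _).le
    _ = 1 := by rw [← Real.exp_add]; simp

lemma signForm_le_of_mem_gridNet {n : ℕ} (hn : 2 ≤ n) (s : Finset (Fin n × Fin n))
    {z : Fin n → ℤ} (hz : z ∈ gridNet n) :
    signForm s (fun i => (z i : ℝ) / n) ≤ √n * (3 * Real.log n + 16) + netExcess s / √n := by
  have hr : 0 < √(n : ℝ) := Real.sqrt_pos.2 (by exact_mod_cast (by omega : 0 < n))
  set u := signForm s (fun i => (z i : ℝ) / n) - √n * (3 * Real.log n + 16) with hu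
  have h1 : Real.exp (√n * u) ≤ netExcess s :=
    Finset.single_le_sum (f := fun z : Fin n → ℤ =>
      Real.exp (√n * (signForm s (fun i => (z i : ℝ) / n) - √n * (3 * Real.log n + 16))))
      (fun _ _ => (Real.exp_pos _).le) hz
  have h2 : √n * u ≤ netExcess s := by linarith [Real.add_one_le_exp (√n * u)]
  have h3 : u ≤ netExcess s / √n := by rw [le_div_iff₀ hr]; linarith
  linarith

lemma sum_abs_le_sqrt {n : ℕ} (hn : 0 < n) {b : Fin n → ℝ} (hb : ∑ i, b i ^ 2 = 1) :
    ∑ i, |b i| ≤ √n := by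
  have hn0 : (0 : ℝ) < n := by exact_mod_cast hn
  refine Real.le_sqrt_of_sq_le ?_
  have := sq_sum_le_card_mul_sum_sq (s := Finset.univ) (f := fun i => |b i|)
  simpa [hb] using this

/-- On unit vectors the form is bounded by rounding each coordinate down to a multiple of `1 / n`:
this moves every product of coordinates by `O((|b i| + |b j|) / n)`, so the form by `O(√n)`. -/
lemma signForm_le_of_sum_sq_eq_one {n : ℕ} (hn : 2 ≤ n) (s : Finset (Fin n × Fin n))
    {b : Fin n → ℝ} (hb : ∑ i, b i ^ 2 = 1) :
    signForm s b ≤ √n * (3 * Real.log n + 19) + netExcess s / √n := by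
  have hn2 : (2 : ℝ) ≤ n := by exact_mod_cast hn
  have hn0 : (0 : ℝ) < n := by linarith
  set z : Fin n → ℤ := fun i => ⌊n * b i⌋ with hz
  set x : Fin n → ℝ := fun i => (z i : ℝ) / n with hx
  have hxb : ∀ i, |b i - x i| ≤ 1 / n := by
    intro i
    have h1 := Int.floor_le (n * b i)
    have h2 := Int.lt_floor_add_one (n * b i)
    have h3 : b i - x i = (n * b i - z i) / n := by simp only [hx]; field_simp
    rw [h3, abs_div, abs_of_pos hn0]
    refine div_le_div_of_nonneg_right ?_ hn0.le
    rw [abs_le]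
    constructor <;> simp only [hz] <;> linarith
  have hb1 : ∀ i, |b i| ≤ 1 := by
    intro i
    rw [← sq_le_one_iff_abs_le_one, ← hb]
    exact Finset.single_le_sum (f := fun i => b i ^ 2) (fun _ _ => sq_nonneg _)
      (Finset.mem_univ i)
  have hmem : z ∈ gridNet n := by
    refine Finset.mem_filter.2 ⟨?_, ?_⟩
    · refine Fintype.mem_piFinset.2 fun i => Finset.mem_Icc.2 ⟨?_, ?_⟩
      · refine Int.le_floor.2 ?_
        push_cast
        nlinarith [(abs_le.1 (hb1 i)).1]
      · refine Int.floor_le_iff.2 ?_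
        push_cast
        nlinarith [(abs_le.1 (hb1 i)).2]
    · have : ∀ i, x i ^ 2 ≤ 2 * b i ^ 2 + 2 * (1 / n) ^ 2 := by
        intro i
        have := sq_le_sq' (abs_le.1 (hxb i)).1 (abs_le.1 (hxb i)).2
        nlinarith [sq_nonneg (2 * b i - x i)]
      calc ∑ i, x i ^ 2 ≤ ∑ i : Fin n, (2 * b i ^ 2 + 2 * (1 / (n : ℝ)) ^ 2) :=
            Finset.sum_le_sum fun i _ => this i
        _ = 2 + 2 / n := by
          rw [Finset.sum_add_distrib, ← Finset.mul_sum, hb, Finset.sum_const, Finset.card_univ,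
            Fintype.card_fin, nsmul_eq_mul]
          field_simp
        _ ≤ 4 := by
          have : 2 / (n : ℝ) ≤ 2 := div_le_self (by norm_num) (by linarith)
          linarith
  have hdiff : signForm s b - signForm s x ≤ 2 * √n + 1 := by
    have hprod : ∀ i j, |b i * b j - x i * x j| ≤ (|b i| + |b j| + 1 / n) / n := by
      intro i j
      have e : b i * b j - x i * x j = b i * (b j - x j) + (b i - x i) * x j := by ring
      have hxj : |x j| ≤ |b j| + 1 / n := by
        have := abs_sub_abs_le_abs_sub (x j) (b j)
        rw [abs_sub_comm] at this
        linarith [hxb j]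
      rw [e]
      calc _ ≤ |b i| * |b j - x j| + |b i - x i| * |x j| := by
            rw [← abs_mul, ← abs_mul]; exact abs_add_le _ _
        _ ≤ |b i| * (1 / n) + 1 / n * (|b j| + 1 / n) := by
            gcongr
            · exact hxb j
            · exact hxb i
        _ = _ := by ring
    set f : Fin n × Fin n → ℝ := fun p => (|b p.1| + |b p.2| + 1 / n) / n with hf
    have hf0 : ∀ p, 0 ≤ f p := fun p => by positivity
    calc signForm s b - signForm s x
        = ∑ e ∈ upperPairs n,
            (if e ∈ s then 1 else -1) * (2 * (b e.1 * b e.2 - x e.1 * x e.2)) := by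
          rw [signForm, signForm, ← Finset.sum_sub_distrib]
          exact Finset.sum_congr rfl fun e _ => by ring
      _ ≤ ∑ e ∈ upperPairs n, (f e + f e.swap) := by
          refine Finset.sum_le_sum fun e _ => ?_
          have h1 := abs_le.1 (hprod e.1 e.2)
          have h2 : f e.swap = f e := by simp only [hf, Prod.fst_swap, Prod.snd_swap]; ring
          have h3 : f e = (|b e.1| + |b e.2| + 1 / n) / n := rfl
          rw [h2, h3]
          split_ifs <;> linarith [h1.1, h1.2]
      _ ≤ ∑ i, ∑ j, f (i, j) := by
          rw [← sum_offDiag_eq_sum_upperPairs]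
          exact sum_offDiag_le_sum_sum f hf0
      _ = 2 * ∑ i, |b i| + 1 := by
          simp only [hf, ← Finset.sum_div, Finset.sum_add_distrib, Finset.sum_const,
            Finset.card_univ, Fintype.card_fin, nsmul_eq_mul, ← Finset.mul_sum]
          field_simp
          ring
      _ ≤ 2 * √n + 1 := by linarith [sum_abs_le_sqrt (by omega) hb]
  have hnet := signForm_le_of_mem_gridNet hn s hmem
  have h1 : 1 ≤ √(n : ℝ) := Real.one_le_sqrt.2 (by linarith)
  change signForm s x ≤ _ at hnet
  linarith

lemma signForm_le {n : ℕ} (hn : 2 ≤ n) (s : Finset (Fin n × Fin n)) (b : Fin n → ℝ) :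
    signForm s b ≤ (∑ i, b i ^ 2) * (√n * (3 * Real.log n + 19) + netExcess s / √n) := by
  have h0 : 0 ≤ ∑ i, b i ^ 2 := Finset.sum_nonneg fun _ _ => sq_nonneg _
  rcases h0.eq_or_lt with h | h
  · have hb : ∀ i, b i = 0 := fun i => by
      have := (Finset.sum_eq_zero_iff_of_nonneg fun _ _ => sq_nonneg _).1 h.symm i
        (Finset.mem_univ i)
      exact pow_eq_zero_iff (two_ne_zero) |>.1 this
    simp [signForm, hb]
  · set c := √(∑ i, b i ^ 2) with hc
    have hc0 : 0 < c := Real.sqrt_pos.2 h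
    have hcc : c ^ 2 = ∑ i, b i ^ 2 := Real.sq_sqrt h0
    have hu : ∑ i, (b i / c) ^ 2 = 1 := by
      simp only [div_pow, ← Finset.sum_div, hcc]
      exact div_self h.ne'
    have hscale : signForm s b = c ^ 2 * signForm s fun i => b i / c := by
      rw [signForm, signForm, Finset.mul_sum]
      refine Finset.sum_congr rfl fun e _ => ?_
      field_simp
    rw [hscale, ← hcc]
    exact mul_le_mul_of_nonneg_left (signForm_le_of_sum_sq_eq_one hn s hu) (sq_nonneg c)

/-- A positive semidefinite matrix is a sum of rank one matrices `v vᵀ`, whose traces add up, so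
that the bound for quadratic forms extends to the pairing with such a matrix. -/
theorem sum_sign_mul_le_of_posSemidef {n : ℕ} (hn : 2 ≤ n) (s : Finset (Fin n × Fin n))
    {M : Matrix (Fin n) (Fin n) ℝ} (hM : M.PosSemidef) :
    ∑ e ∈ upperPairs n, (if e ∈ s then 1 else -1) * (2 * M e.1 e.2)
      ≤ M.trace * (√n * (3 * Real.log n + 19) + netExcess s / √n) := by
  obtain ⟨m, v, hv⟩ := Matrix.posSemidef_iff_eq_sum_vecMulVec.1 hM
  have hent : ∀ i j, M i j = ∑ k, v k i * v k j := fun i j => by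
    rw [hv]
    simp [Matrix.sum_apply, Matrix.vecMulVec_apply]
  have htr : M.trace = ∑ k, ∑ i, v k i ^ 2 := by
    rw [Matrix.trace, Finset.sum_comm]
    refine Finset.sum_congr rfl fun i _ => ?_
    rw [Matrix.diag_apply, hent]
    exact Finset.sum_congr rfl fun k _ => (sq _).symm
  have hsum : ∑ e ∈ upperPairs n, (if e ∈ s then 1 else -1) * (2 * M e.1 e.2)
      = ∑ k, signForm s (v k) := by
    simp only [signForm]
    rw [Finset.sum_comm]
    refine Finset.sum_congr rfl fun e _ => ?_
    rw [hent, Finset.mul_sum, Finset.mul_sum]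
  rw [hsum, htr, Finset.sum_mul]
  exact Finset.sum_le_sum fun k _ => signForm_le hn s (v k)

/-! ### The centred log likelihood -/

lemma le_log_of_two_le {n : ℕ} (hn : 2 ≤ n) : 0.69 ≤ Real.log n := by
  have h2 : Real.log 2 ≤ Real.log n :=
    Real.log_le_log (by norm_num) (by exact_mod_cast hn)
  linarith [Real.log_two_gt_d9]

/-- The log odds of the probability `x`. -/
noncomputable def logit (x : ℝ) : ℝ := Real.log x - Real.log (1 - x)

lemma abs_logit_sub_le {n : ℕ} (hn : 0 < n) {x y : ℝ} (hx : x ∈ Set.Icc (1 / (n : ℝ)) (1 - 1 / n))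
    (hy : y ∈ Set.Icc (1 / (n : ℝ)) (1 - 1 / n)) :
    |logit x - logit y| ≤ 2 * n * |x - y| := by
  have hn0 : (0 : ℝ) < n := by exact_mod_cast hn
  have hinv : (0 : ℝ) < 1 / n := by positivity
  have key : ∀ a b : ℝ, 1 / (n : ℝ) ≤ a → 1 / (n : ℝ) ≤ b →
      Real.log a - Real.log b ≤ n * |a - b| := by
    intro a b ha hb
    have ha0 : 0 < a := hinv.trans_le ha
    have hb0 : 0 < b := hinv.trans_le hb
    rw [← Real.log_div ha0.ne' hb0.ne']
    have h1 := Real.log_le_sub_one_of_pos (div_pos ha0 hb0)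
    have h2 : a / b - 1 = (a - b) * b⁻¹ := by field_simp
    have h3 : b⁻¹ ≤ n := by
      rw [inv_le_comm₀ hb0 hn0, inv_eq_one_div]
      exact hb
    calc _ ≤ (a - b) * b⁻¹ := h1.trans_eq h2
      _ ≤ |a - b| * n := mul_le_mul (le_abs_self _) h3 (inv_pos.2 hb0).le (abs_nonneg _)
      _ = _ := mul_comm _ _
  have main : ∀ x y : ℝ, x ∈ Set.Icc (1 / (n : ℝ)) (1 - 1 / n) →
      y ∈ Set.Icc (1 / (n : ℝ)) (1 - 1 / n) → logit x - logit y ≤ 2 * n * |x - y| := by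
    intro x y hx hy
    have h1 := key x y hx.1 hy.1
    have h2 := key (1 - y) (1 - x) (by linarith [hy.2]) (by linarith [hx.2])
    have h3 : |1 - y - (1 - x)| = |x - y| := by congr 1; ring
    rw [h3] at h2
    unfold logit
    linarith
  refine abs_sub_le_iff.2 ⟨main x y hx hy, ?_⟩
  rw [abs_sub_comm]
  exact main y x hy hx

lemma abs_logit_le {n : ℕ} (hn : 0 < n) {x : ℝ} (hx : x ∈ Set.Icc (1 / (n : ℝ)) (1 - 1 / n)) :
    |logit x| ≤ Real.log n := by
  have hn0 : (0 : ℝ) < n := by exact_mod_cast hn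
  have hinv : (0 : ℝ) < 1 / n := by positivity
  have key : ∀ a : ℝ, 1 / (n : ℝ) ≤ a → a ≤ 1 → -Real.log n ≤ Real.log a ∧ Real.log a ≤ 0 := by
    intro a ha ha1
    refine ⟨?_, Real.log_nonpos (hinv.le.trans ha) ha1⟩
    rw [← Real.log_inv, inv_eq_one_div]
    exact Real.log_le_log hinv ha
  have h1 := key x hx.1 (by linarith [hx.2])
  have h2 := key (1 - x) (by linarith [hx.2]) (by linarith [hx.1])
  rw [abs_le]
  unfold logit
  constructor <;> linarith [h1.1, h1.2, h2.1, h2.2]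

section feasible

variable {n : ℕ} {M : Matrix (Fin n) (Fin n) ℝ}

lemma symm_of_mem_feasible (hM : M ∈ feasible n) (i j : Fin n) : M j i = M i j := by
  simpa using hM.1.1.apply i j

lemma apply_mem_Icc_of_mem_feasible (hM : M ∈ feasible n) {i j : Fin n} (h : i ≠ j) :
    M i j ∈ Set.Icc (1 / (n : ℝ)) (1 - 1 / n) := hM.2 i j h

/-- Testing positive semidefiniteness on `e i - e j` gives `2 / n ≤ M i i + M j j` for `i ≠ j`. -/
lemma one_le_trace_of_mem_feasible (hn : 2 ≤ n) (hM : M ∈ feasible n) : 1 ≤ M.trace := by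
  have hn2 : (2 : ℝ) ≤ n := by exact_mod_cast hn
  have hpair : ∀ i j, (2 / n - if i = j then 2 / (n : ℝ) - 2 * M i i else 0) ≤ M i i + M j j := by
    intro i j
    split_ifs with h
    · subst h; linarith
    · obtain ⟨m, v, hv⟩ := Matrix.posSemidef_iff_eq_sum_vecMulVec.1 hM.1
      have hent : ∀ i j, M i j = ∑ k, v k i * v k j := fun i j => by
        rw [hv]
        simp [Matrix.sum_apply, Matrix.vecMulVec_apply]
      have h1 : 2 * M i j ≤ M i i + M j j := by
        rw [hent, hent, hent, Finset.mul_sum, ← Finset.sum_add_distrib]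
        exact Finset.sum_le_sum fun k _ => by nlinarith [sq_nonneg (v k i - v k j)]
      have h2 := (hM.2 i j h).1
      have h3 : 2 / (n : ℝ) = 2 * (1 / n) := by ring
      rw [h3]
      linarith
  have hsum : ∑ i : Fin n, ∑ j : Fin n, (2 / n - if i = j then 2 / (n : ℝ) - 2 * M i i else 0)
      ≤ ∑ i : Fin n, ∑ j : Fin n, (M i i + M j j) :=
    Finset.sum_le_sum fun i _ => Finset.sum_le_sum fun j _ => hpair i j
  simp only [Finset.sum_sub_distrib, Finset.sum_add_distrib, Finset.sum_ite_eq, Finset.mem_univ,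
    if_true, Finset.sum_const, Finset.card_univ, Fintype.card_fin, nsmul_eq_mul,
    ← Finset.mul_sum] at hsum
  have htr : ∑ i, M i i = M.trace := rfl
  rw [htr] at hsum
  have h4 : (n : ℝ) * (n * (2 / n)) - (n * (2 / n) - 2 * M.trace) = 2 * n - 2 + 2 * M.trace := by
    field_simp
    ring
  rw [h4] at hsum
  nlinarith

lemma const_mem_feasible (hn : 2 ≤ n) :
    (Matrix.of fun _ _ => 1 / (n : ℝ) : Matrix (Fin n) (Fin n) ℝ) ∈ feasible n := by
  have hn2 : (2 : ℝ) ≤ n := by exact_mod_cast hn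
  refine ⟨?_, fun i j _ => ⟨le_rfl, ?_⟩⟩
  · refine Matrix.posSemidef_iff_eq_sum_vecMulVec.2 ⟨1, fun _ _ => √(1 / n), ?_⟩
    ext i j
    have : (0 : ℝ) ≤ 1 / n := by positivity
    simp only [Finset.univ_unique, Finset.sum_const, Finset.card_singleton, one_smul,
      Matrix.vecMulVec_apply, Matrix.of_apply, star_trivial]
    exact (Real.mul_self_sqrt this).symm
  · have : 1 / (n : ℝ) ≤ 1 / 2 := one_div_le_one_div_of_le (by norm_num) hn2
    simp only [Matrix.of_apply]
    linarith

lemma trace_const (hn : 2 ≤ n) :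
    (Matrix.of fun _ _ => 1 / (n : ℝ) : Matrix (Fin n) (Fin n) ℝ).trace = 1 := by
  have hn0 : (n : ℝ) ≠ 0 := by exact_mod_cast (by omega : n ≠ 0)
  simp [Matrix.trace, hn0]

end feasible

/-- The deviation of the log likelihood of `M` from its mean under the edge probabilities `P`, for
the graph with edge set `s ⊆ upperPairs n`. -/
noncomputable def noise {n : ℕ} (P : Matrix (Fin n) (Fin n) ℝ) (s : Finset (Fin n × Fin n))
    (M : Matrix (Fin n) (Fin n) ℝ) : ℝ :=
  ∑ e ∈ upperPairs n, ((if e ∈ s then 1 else 0) - P e.1 e.2) * (2 * logit (M e.1 e.2))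

section noise

variable {n : ℕ} {P : Matrix (Fin n) (Fin n) ℝ}

lemma apply_mem_unitInterval_of_mem_feasible (hP : P ∈ feasible n) :
    ∀ e ∈ upperPairs n, 0 ≤ P e.1 e.2 ∧ P e.1 e.2 ≤ 1 := by
  intro e he
  have h := hP.2 e.1 e.2 (mem_upperPairs.1 he).ne
  have : (0 : ℝ) ≤ 1 / n := by positivity
  exact ⟨this.trans h.1, h.2.trans (by linarith)⟩

lemma two_mul_card_upperPairs_le (n : ℕ) : 2 * ((upperPairs n).card : ℝ) ≤ n * n := by
  have h1 := sum_offDiag_eq_sum_upperPairs (n := n) fun _ => 1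
  have h2 := sum_offDiag_le_sum_sum (n := n) (fun _ => 1) fun _ => zero_le_one
  rw [h1] at h2
  simp only [Finset.sum_const, Finset.card_univ, Fintype.card_fin, nsmul_eq_mul] at h2
  linarith

lemma noise_le (hn : 0 < n) (hP : P ∈ feasible n) (s : Finset (Fin n × Fin n))
    {M : Matrix (Fin n) (Fin n) ℝ} (hM : M ∈ feasible n) :
    noise P s M ≤ n * n * Real.log n := by
  have hl : 0 ≤ Real.log n := Real.log_natCast_nonneg n
  calc noise P s M ≤ ∑ e ∈ upperPairs n, 2 * Real.log n := by
        refine Finset.sum_le_sum fun e he => ?_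
        have h1 := abs_logit_le hn (apply_mem_Icc_of_mem_feasible hM (mem_upperPairs.1 he).ne)
        have h2 := apply_mem_unitInterval_of_mem_feasible hP e he
        refine (le_abs_self _).trans ?_
        rw [abs_mul, abs_mul, abs_two]
        have h3 : |(if e ∈ s then (1 : ℝ) else 0) - P e.1 e.2| ≤ 1 := by
          rw [abs_le]
          split_ifs <;> constructor <;> linarith [h2.1, h2.2]
        calc _ ≤ 1 * (2 * Real.log n) :=
              mul_le_mul h3 (by linarith) (by positivity) zero_le_one
          _ = _ := one_mul _
    _ = 2 * (upperPairs n).card * Real.log n := by rw [Finset.sum_const, nsmul_eq_mul]; ring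
    _ ≤ _ := mul_le_mul_of_nonneg_right (two_mul_card_upperPairs_le n) hl

/-- For a fixed matrix there is no supremum, and the second moment suffices. -/
lemma bernoulliAvg_abs_noise_le (hn : 2 ≤ n) (hP : P ∈ feasible n)
    {M : Matrix (Fin n) (Fin n) ℝ} (hM : M ∈ feasible n) :
    bernoulliAvg (fun e => P e.1 e.2) (upperPairs n) (fun s => |noise P s M|)
      ≤ n * Real.log n := by
  have hp := apply_mem_unitInterval_of_mem_feasible hP
  have hl := le_log_of_two_le hn
  have hn0 : (0 : ℝ) < n := by exact_mod_cast (by omega : 0 < n)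
  set κ := (n : ℝ) * Real.log n with hκ
  have hκ0 : 0 < κ := mul_pos hn0 (by linarith)
  have hsq := bernoulliAvg_sq (p := fun e : Fin n × Fin n => P e.1 e.2) (E := upperPairs n) 0
    fun e => 2 * logit (M e.1 e.2)
  simp only [zero_add, zero_pow two_ne_zero] at hsq
  have hvar : ∑ e ∈ upperPairs n, P e.1 e.2 * (1 - P e.1 e.2) * (2 * logit (M e.1 e.2)) ^ 2
      ≤ κ ^ 2 := by
    calc _ ≤ ∑ e ∈ upperPairs n, Real.log n ^ 2 := by
          refine Finset.sum_le_sum fun e he => ?_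
          have h1 := abs_logit_le (by omega)
            (apply_mem_Icc_of_mem_feasible hM (mem_upperPairs.1 he).ne)
          have h2 := sq_le_sq' (abs_le.1 h1).1 (abs_le.1 h1).2
          have h3 : P e.1 e.2 * (1 - P e.1 e.2) ≤ 1 / 4 := by
            nlinarith [sq_nonneg (P e.1 e.2 - 1 / 2)]
          calc _ ≤ 1 / 4 * (2 * logit (M e.1 e.2)) ^ 2 :=
                mul_le_mul_of_nonneg_right h3 (sq_nonneg _)
            _ = logit (M e.1 e.2) ^ 2 := by ring
            _ ≤ _ := h2
      _ = (upperPairs n).card * Real.log n ^ 2 := by rw [Finset.sum_const, nsmul_eq_mul]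
      _ ≤ n * n * Real.log n ^ 2 := by
          refine mul_le_mul_of_nonneg_right ?_ (sq_nonneg _)
          have h1 := two_mul_card_upperPairs_le n
          have h2 : (0 : ℝ) ≤ (upperPairs n).card := Nat.cast_nonneg _
          linarith
      _ = κ ^ 2 := by rw [hκ]; ring
  calc _ ≤ bernoulliAvg (fun e => P e.1 e.2) (upperPairs n)
        (fun s => 1 / (2 * κ) * noise P s M ^ 2 + κ / 2) := by
        refine bernoulliAvg_mono hp fun s _ => ?_
        rw [← sq_abs (noise P s M), ← sub_nonneg]
        have : 1 / (2 * κ) * |noise P s M| ^ 2 + κ / 2 - |noise P s M|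
            = (|noise P s M| - κ) ^ 2 / (2 * κ) := by
          field_simp
          ring
        rw [this]
        positivity
    _ = 1 / (2 * κ) * ∑ e ∈ upperPairs n,
          P e.1 e.2 * (1 - P e.1 e.2) * (2 * logit (M e.1 e.2)) ^ 2 + κ / 2 := by
        rw [bernoulliAvg_add, bernoulliAvg_const_mul, bernoulliAvg_const, ← hsq]
        rfl
    _ ≤ 1 / (2 * κ) * κ ^ 2 + κ / 2 := by gcongr
    _ = κ := by field_simp; ring

/-- The uniform deviation bound with a trace penalty, along a selection of matrices of trace at most
`√n`: after symmetrization and contraction, the penalty absorbs the typical size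
`O(n √n log n) * tr M` of the linear sign process. -/
lemma bernoulliAvg_noise_sub_trace_le (hn : 2 ≤ n) (hP : P ∈ feasible n)
    (x : Finset (Fin n × Fin n) → {M // M ∈ feasible n ∧ M.trace ≤ √n}) :
    bernoulliAvg (fun e => P e.1 e.2) (upperPairs n)
        (fun s => -(62 * n * √n * Real.log n * (x s).1.trace) + noise P s (x s))
      ≤ 2 * n := by
  have hl := le_log_of_two_le hn
  have hn0 : (0 : ℝ) < n := by exact_mod_cast (by omega : 0 < n)
  have hr : 0 < √(n : ℝ) := Real.sqrt_pos.2 hn0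
  obtain ⟨y, hy⟩ := bernoulliAvg_contraction (apply_mem_unitInterval_of_mem_feasible hP)
    (fun e (M : {M // M ∈ feasible n ∧ M.trace ≤ √n}) => 2 * logit (M.1 e.1 e.2))
    (fun e M => 2 * n * (2 * M.1 e.1 e.2))
    (by
      intro e he M N
      have h := abs_logit_sub_le (by omega)
        (apply_mem_Icc_of_mem_feasible M.2.1 (mem_upperPairs.1 he).ne)
        (apply_mem_Icc_of_mem_feasible N.2.1 (mem_upperPairs.1 he).ne)
      have h1 : 2 * n * (2 * M.1 e.1 e.2) - 2 * n * (2 * N.1 e.1 e.2)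
          = 2 * (2 * n * (M.1 e.1 e.2 - N.1 e.1 e.2)) := by ring
      rw [h1, ← mul_sub, abs_mul, abs_mul, abs_mul (2 * (n : ℝ)), abs_two,
        abs_of_pos (by positivity : 0 < 2 * (n : ℝ))]
      linarith)
    (fun M => -(62 * n * √n * Real.log n * M.1.trace)) x
  calc _ ≤ _ := hy
    _ ≤ bernoulliAvg (fun _ => 1 / 2) (upperPairs n) (fun s => 2 * n * netExcess s) := by
      refine bernoulliAvg_mono (fun _ _ => by norm_num) fun s _ => ?_
      have hM := sum_sign_mul_le_of_posSemidef hn s (y s).2.1.1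
      have htr0 : 0 ≤ (y s).1.trace := (y s).2.1.1.trace_nonneg
      have hR : (y s).1.trace * (netExcess s / √n) ≤ netExcess s := by
        calc _ ≤ √n * (netExcess s / √n) :=
              mul_le_mul_of_nonneg_right (y s).2.2 (div_nonneg (netExcess_nonneg s) hr.le)
          _ = _ := by field_simp
      have hsum : ∑ e ∈ upperPairs n, (if e ∈ s then 1 else -1) * (2 * n * (2 * (y s).1 e.1 e.2))
          = 2 * n * ∑ e ∈ upperPairs n, (if e ∈ s then 1 else -1) * (2 * (y s).1 e.1 e.2) := by
        rw [Finset.mul_sum]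
        exact Finset.sum_congr rfl fun e _ => by ring
      rw [hsum]
      have h1 := mul_le_mul_of_nonneg_left (hM.trans_eq (mul_add _ _ _))
        (by positivity : 0 ≤ 2 * (n : ℝ))
      have h2 := mul_le_mul_of_nonneg_left hR (by positivity : 0 ≤ 2 * (n : ℝ))
      have h3 : 0 ≤ n * √n * (y s).1.trace * (28 * Real.log n - 19) :=
        mul_nonneg (by positivity) (by linarith)
      linarith
    _ ≤ 2 * n * 1 := by
      rw [bernoulliAvg_const_mul]
      exact mul_le_mul_of_nonneg_left (bernoulliAvg_netExcess_le hn) (by positivity)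
    _ = _ := mul_one _

/-- The expected positive part of the deviation at a data-dependent matrix is at most
`O(n √n log n)` times the expected trace. Outcomes where the trace exceeds `√n` are covered by the
trivial bound `n ^ 2 log n` on the deviation. -/
theorem bernoulliAvg_max_noise_le (hn : 2 ≤ n) (hP : P ∈ feasible n)
    (M : Finset (Fin n × Fin n) → Matrix (Fin n) (Fin n) ℝ) (hM : ∀ s, M s ∈ feasible n) :
    bernoulliAvg (fun e => P e.1 e.2) (upperPairs n) (fun s => max 0 (noise P s (M s)))
      ≤ 128 * n * √n * Real.log n
        * bernoulliAvg (fun e => P e.1 e.2) (upperPairs n) (fun s => (M s).trace) := by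
  have hp := apply_mem_unitInterval_of_mem_feasible hP
  have hl := le_log_of_two_le hn
  have hn2 : (2 : ℝ) ≤ n := by exact_mod_cast hn
  have hn0 : (0 : ℝ) < n := by linarith
  have hr : 1 ≤ √(n : ℝ) := Real.one_le_sqrt.2 (by linarith)
  have hrr : √(n : ℝ) * √n = n := Real.mul_self_sqrt hn0.le
  set Λ := 62 * n * √n * Real.log n with hΛ
  have hΛ0 : 0 ≤ Λ := by positivity
  set J : Matrix (Fin n) (Fin n) ℝ := Matrix.of fun _ _ => 1 / (n : ℝ) with hJ
  have hJf : J ∈ feasible n := const_mem_feasible hn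
  have hJtr : J.trace = 1 := trace_const hn
  -- Falling back on `J` where the penalized deviation is negative keeps it bounded below.
  let x : Finset (Fin n × Fin n) → {M // M ∈ feasible n ∧ M.trace ≤ √n} := fun s =>
    if h : (M s).trace ≤ √n ∧ 0 ≤ -(Λ * (M s).trace) + noise P s (M s) then ⟨M s, hM s, h.1⟩
    else ⟨J, hJf, hJtr.le.trans hr⟩
  have hpt : ∀ s, max 0 (noise P s (M s)) ≤ Λ * (M s).trace
      + ((-(Λ * (x s).1.trace) + noise P s (x s)) + (|noise P s J| + Λ)) := by
    intro s
    have htr : 0 ≤ Λ * (M s).trace :=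
      mul_nonneg hΛ0 (zero_le_one.trans (one_le_trace_of_mem_feasible hn (hM s)))
    have habs := abs_nonneg (noise P s J)
    by_cases h : (M s).trace ≤ √n ∧ 0 ≤ -(Λ * (M s).trace) + noise P s (M s)
    · have hx : x s = ⟨M s, hM s, h.1⟩ := dif_pos h
      rw [hx]
      refine max_le ?_ ?_ <;> simp only <;> linarith [h.2]
    · have hx : x s = ⟨J, hJf, hJtr.le.trans hr⟩ := dif_neg h
      have hneg := neg_abs_le (noise P s J)
      have hle : noise P s (M s) ≤ Λ * (M s).trace := by
        by_cases h1 : (M s).trace ≤ √n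
        · have : ¬ 0 ≤ -(Λ * (M s).trace) + noise P s (M s) := fun h2 => h ⟨h1, h2⟩
          linarith
        · calc _ ≤ n * n * Real.log n := noise_le (by omega) hP s (hM s)
            _ ≤ 62 * (n * n * Real.log n) := by
              have : 0 ≤ n * n * Real.log n := by positivity
              linarith
            _ = Λ * √n := by rw [hΛ]; linear_combination (-(62 * n * Real.log n)) * hrr
            _ ≤ _ := mul_le_mul_of_nonneg_left (not_le.1 h1).le hΛ0
      rw [hx]
      refine max_le ?_ ?_ <;> simp only [hJtr] <;> linarith
  have hT : 1 ≤ bernoulliAvg (fun e => P e.1 e.2) (upperPairs n) (fun s => (M s).trace) := by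
    calc (1 : ℝ) = bernoulliAvg (fun e => P e.1 e.2) (upperPairs n) (fun _ => 1) :=
          (bernoulliAvg_const 1).symm
      _ ≤ _ := bernoulliAvg_mono hp fun s _ => one_le_trace_of_mem_feasible hn (hM s)
  set T := bernoulliAvg (fun e => P e.1 e.2) (upperPairs n) (fun s => (M s).trace) with hTdef
  have h1 := bernoulliAvg_noise_sub_trace_le hn hP x
  have h2 := bernoulliAvg_abs_noise_le hn hP hJf
  have h3 : n * Real.log n ≤ n * √n * Real.log n := by
    have : 0 ≤ n * Real.log n * (√n - 1) :=
      mul_nonneg (by positivity) (by linarith)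
    linarith
  have h4 : 2 * n ≤ 3 * (n * Real.log n) := by nlinarith
  have h5 : 66 * (n * √n * Real.log n) * 1 ≤ 66 * (n * √n * Real.log n) * T :=
    mul_le_mul_of_nonneg_left hT (by positivity)
  calc _ ≤ _ := bernoulliAvg_mono hp fun s _ => hpt s
    _ = Λ * T + (bernoulliAvg (fun e => P e.1 e.2) (upperPairs n)
          (fun s => -(Λ * (x s).1.trace) + noise P s (x s))
        + (bernoulliAvg (fun e => P e.1 e.2) (upperPairs n) (fun s => |noise P s J|) + Λ)) := by
      rw [bernoulliAvg_add, bernoulliAvg_const_mul, bernoulliAvg_add (g := fun s => _ + Λ),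
        bernoulliAvg_add (f := fun s => |noise P s J|), bernoulliAvg_const]
    _ ≤ Λ * T + (2 * n + (n * Real.log n + Λ)) := by gcongr
    _ ≤ _ := by rw [hΛ]; linarith

end noise

/-! ### Graphs as edge sets, and the law of the random graph -/

section graph

variable {n : ℕ}

/-- The graph on `Fin n` with the edges `{i, j}` for `(i, j) ∈ s`. -/
def graphOfPairs (s : Finset (Fin n × Fin n)) : SimpleGraph (Fin n) :=
  SimpleGraph.fromRel fun i j => (i, j) ∈ s

open Classical in
/-- The edges of `G`, each listed as the pair with increasing entries. -/
noncomputable def edgePairs (G : SimpleGraph (Fin n)) : Finset (Fin n × Fin n) :=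
  {p ∈ upperPairs n | G.Adj p.1 p.2}

lemma mem_edgePairs {G : SimpleGraph (Fin n)} {p : Fin n × Fin n} :
    p ∈ edgePairs G ↔ p.1 < p.2 ∧ G.Adj p.1 p.2 := by
  simp [edgePairs, mem_upperPairs]

lemma graphOfPairs_edgePairs (G : SimpleGraph (Fin n)) : graphOfPairs (edgePairs G) = G := by
  ext i j
  simp only [graphOfPairs, SimpleGraph.fromRel_adj, mem_edgePairs]
  constructor
  · rintro ⟨-, h | h⟩
    · exact h.2
    · exact h.2.symm
  · intro h
    refine ⟨h.ne, ?_⟩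
    rcases lt_or_gt_of_ne h.ne with h' | h'
    · exact Or.inl ⟨h', h⟩
    · exact Or.inr ⟨h', h.symm⟩

lemma edgePairs_graphOfPairs {s : Finset (Fin n × Fin n)} (hs : s ⊆ upperPairs n) :
    edgePairs (graphOfPairs s) = s := by
  ext ⟨i, j⟩
  simp only [mem_edgePairs, graphOfPairs, SimpleGraph.fromRel_adj]
  constructor
  · rintro ⟨hlt, -, h | h⟩
    · exact h
    · exact absurd (mem_upperPairs.1 (hs h)) (not_lt.2 hlt.le)
  · intro h
    have hlt : i < j := mem_upperPairs.1 (hs h)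
    exact ⟨hlt, hlt.ne, Or.inl h⟩

lemma graphMass_eq_prod (P : Matrix (Fin n) (Fin n) ℝ) (G : SimpleGraph (Fin n)) :
    graphMass P G
      = ∏ e ∈ upperPairs n, if e ∈ edgePairs G then P e.1 e.2 else 1 - P e.1 e.2 := by
  unfold graphMass
  refine Finset.prod_congr rfl fun e he => ?_
  have : e ∈ edgePairs G ↔ G.Adj e.1 e.2 := by
    rw [mem_edgePairs, and_iff_right (mem_upperPairs.1 he)]
  classical exact if_congr this.symm rfl rfl

lemma sum_graphMass_mul (P : Matrix (Fin n) (Fin n) ℝ) (F : SimpleGraph (Fin n) → ℝ) :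
    ∑ G, graphMass P G * F G
      = bernoulliAvg (fun e => P e.1 e.2) (upperPairs n) fun s => F (graphOfPairs s) := by
  refine Finset.sum_nbij' edgePairs graphOfPairs ?_ ?_ ?_ ?_ ?_
  · exact fun G _ => Finset.mem_powerset.2
      fun e he => mem_upperPairs.2 (mem_edgePairs.1 he).1
  · exact fun s _ => Finset.mem_univ _
  · exact fun G _ => graphOfPairs_edgePairs G
  · exact fun s hs => edgePairs_graphOfPairs (Finset.mem_powerset.1 hs)
  · intro G _
    beta_reduce
    rw [graphOfPairs_edgePairs, graphMass_eq_prod]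

lemma graphMass_nonneg {P : Matrix (Fin n) (Fin n) ℝ} (hP : P ∈ feasible n)
    (G : SimpleGraph (Fin n)) : 0 ≤ graphMass P G := by
  rw [graphMass_eq_prod]
  refine Finset.prod_nonneg fun e he => ?_
  have := apply_mem_unitInterval_of_mem_feasible hP e he
  split_ifs
  · exact this.1
  · linarith [this.2]

lemma measurableSingletonClass_simpleGraph : MeasurableSingletonClass (SimpleGraph (Fin n)) := by
  refine ⟨fun G => ?_⟩
  have : {G} = SimpleGraph.edgeSet ⁻¹' {G.edgeSet} := by
    ext H
    simp
  rw [this]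
  exact SimpleGraph.measurable_edgeSet (measurableSet_singleton _)

attribute [local instance] measurableSingletonClass_simpleGraph

open Classical in
lemma graphLaw_real_apply {P : Matrix (Fin n) (Fin n) ℝ} (hP : P ∈ feasible n)
    (S : Set (SimpleGraph (Fin n))) :
    (graphLaw P).real S = ∑ G, graphMass P G * if G ∈ S then 1 else 0 := by
  have hS : MeasurableSet S := S.toFinite.measurableSet
  have h0 := graphMass_nonneg hP
  rw [Measure.real, graphLaw, Measure.sum_apply _ hS, tsum_fintype, ENNReal.toReal_sum]
  · refine Finset.sum_congr rfl fun G _ => ?_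
    rw [Measure.smul_apply, Measure.dirac_apply' _ hS, smul_eq_mul, ENNReal.toReal_mul,
      ENNReal.toReal_ofReal (h0 G)]
    by_cases h : G ∈ S <;> simp [h]
  · intro G _
    rw [Measure.smul_apply, Measure.dirac_apply' _ hS, smul_eq_mul]
    refine ENNReal.mul_ne_top ENNReal.ofReal_ne_top ?_
    by_cases h : G ∈ S <;> simp [h]

lemma integral_graphLaw {P : Matrix (Fin n) (Fin n) ℝ} (hP : P ∈ feasible n)
    (F : SimpleGraph (Fin n) → ℝ) :
    ∫ G, F G ∂(graphLaw P) = ∑ G, graphMass P G * F G := by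
  classical
  have : IsFiniteMeasure (graphLaw P) := by
    refine ⟨?_⟩
    rw [graphLaw, Measure.sum_apply _ MeasurableSet.univ, tsum_fintype]
    refine ENNReal.sum_lt_top.2 fun G _ => ?_
    simp
  rw [integral_fintype Integrable.of_finite]
  refine Finset.sum_congr rfl fun G _ => ?_
  rw [graphLaw_real_apply hP, smul_eq_mul]
  congr 1
  simp

/-- Markov's inequality for the law of the random graph. -/
lemma one_sub_le_graphLaw_real {P : Matrix (Fin n) (Fin n) ℝ} (hP : P ∈ feasible n)
    {Y : SimpleGraph (Fin n) → ℝ} (hY : ∀ G, 0 ≤ Y G) {S : Set (SimpleGraph (Fin n))} {t δ : ℝ}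
    (ht : 0 < t) (hE : ∑ G, graphMass P G * Y G ≤ δ * t) (hS : ∀ G, Y G ≤ t → G ∈ S) :
    1 - δ ≤ (graphLaw P).real S := by
  classical
  have hone : ∑ G, graphMass P G * 1 = 1 := by
    rw [sum_graphMass_mul P fun _ => 1, bernoulliAvg_const]
  rw [graphLaw_real_apply hP]
  have h1 : ∑ G, graphMass P G * 1
      ≤ ∑ G, (graphMass P G * (if G ∈ S then 1 else 0) + graphMass P G * Y G / t) := by
    refine Finset.sum_le_sum fun G _ => ?_
    rw [mul_div_assoc, ← mul_add]
    refine mul_le_mul_of_nonneg_left ?_ (graphMass_nonneg hP G)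
    by_cases h : G ∈ S
    · simpa [h] using div_nonneg (hY G) ht.le
    · have : t < Y G := not_le.1 fun h' => h (hS G h')
      simpa [h] using (one_le_div ht).2 this.le
  rw [Finset.sum_add_distrib, hone, ← Finset.sum_div] at h1
  have h2 : (∑ G, graphMass P G * Y G) / t ≤ δ := (div_le_iff₀ ht).2 hE
  linarith

/-! ### Divergence and deviation -/

/-- The deviation `noise` is the log likelihood minus its mean. -/
lemma noise_edgePairs_eq {P M : Matrix (Fin n) (Fin n) ℝ} (hP : P ∈ feasible n)
    (hM : M ∈ feasible n) (G : SimpleGraph (Fin n)) :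
    noise P (edgePairs G) M = logLik G M
      - ∑ p ∈ (Finset.univ : Finset (Fin n)).offDiag,
        (P p.1 p.2 * Real.log (M p.1 p.2) + (1 - P p.1 p.2) * Real.log (1 - M p.1 p.2)) := by
  classical
  rw [logLik, ← Finset.sum_sub_distrib, sum_offDiag_eq_sum_upperPairs, noise]
  refine Finset.sum_congr rfl fun e he => ?_
  have hadj : e ∈ edgePairs G ↔ G.Adj e.1 e.2 := by
    rw [mem_edgePairs, and_iff_right (mem_upperPairs.1 he)]
  simp only [Prod.fst_swap, Prod.snd_swap, symm_of_mem_feasible hP e.1 e.2,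
    symm_of_mem_feasible hM e.1 e.2, G.adj_comm e.2 e.1, hadj, logit]
  split_ifs <;> ring

lemma klDiv_eq (hn : 2 ≤ n) {P M : Matrix (Fin n) (Fin n) ℝ} (hP : P ∈ feasible n)
    (hM : M ∈ feasible n) (G : SimpleGraph (Fin n)) :
    klDiv P M = (noise P (edgePairs G) M - logLik G M - bernoulliEntropy P)
      / ((n : ℝ) * (n - 1)) := by
  have hinv : (0 : ℝ) < 1 / n := by
    have : (0 : ℝ) < n := by exact_mod_cast (by omega : 0 < n)
    positivity
  have hterm : ∀ p ∈ (Finset.univ : Finset (Fin n)).offDiag,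
      P p.1 p.2 * Real.log (M p.1 p.2 / P p.1 p.2)
        + (1 - P p.1 p.2) * Real.log ((1 - M p.1 p.2) / (1 - P p.1 p.2))
      = (P p.1 p.2 * Real.log (M p.1 p.2) + (1 - P p.1 p.2) * Real.log (1 - M p.1 p.2))
        - (P p.1 p.2 * Real.log (P p.1 p.2)
          + (1 - P p.1 p.2) * Real.log (1 - P p.1 p.2)) := by
    intro p hp
    have hne := (Finset.mem_offDiag.1 hp).2.2
    have h1 := hP.2 p.1 p.2 hne
    have h2 := hM.2 p.1 p.2 hne
    rw [Real.log_div (by linarith [h2.1]) (by linarith [h1.1]),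
      Real.log_div (by linarith [h2.2]) (by linarith [h1.2])]
    ring
  rw [klDiv, Finset.sum_congr rfl hterm, Finset.sum_sub_distrib, noise_edgePairs_eq hP hM,
    bernoulliEntropy]
  ring

lemma entropy_le_bernoulliEntropy {P : Matrix (Fin n) (Fin n) ℝ} (hP : P ∈ feasible n) :
    entropy P ≤ bernoulliEntropy P := by
  have hinv : (0 : ℝ) ≤ 1 / n := by positivity
  refine neg_le_neg (Finset.sum_le_sum fun p hp => ?_)
  have h := hP.2 p.1 p.2 (Finset.mem_offDiag.1 hp).2.2
  have : (1 - P p.1 p.2) * Real.log (1 - P p.1 p.2) ≤ 0 :=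
    mul_nonpos_of_nonneg_of_nonpos (by linarith [h.2])
      (Real.log_nonpos (by linarith [h.2]) (by linarith [h.1]))
  linarith

/-- Optimality against the feasible point `P` turns a bound on the deviation at the estimate into a
bound on the divergence. -/
lemma klDiv_le_klBound (hn : 2 ≤ n) {K C δ T : ℝ} {P M : Matrix (Fin n) (Fin n) ℝ}
    {G : SimpleGraph (Fin n)} (hP : P ∈ feasible n) (hopt : IsOptimal C G M)
    (h : noise P (edgePairs G) M
      ≤ K * T * Real.log n / (δ * √n) * ((n : ℝ) * (n - 1))) :
    klDiv P M ≤ klBound K C δ T (bernoulliEntropy P) G P M := by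
  have hn2 : (2 : ℝ) ≤ n := by exact_mod_cast hn
  have hN : 0 < (n : ℝ) * (n - 1) := mul_pos (by linarith) (by linarith)
  have ho := hopt.2 P hP
  unfold regLogLik at ho
  rw [klDiv_eq hn hP hopt.1 G, klBound, ← add_sub_assoc', ← sub_div, div_le_iff₀ hN, add_mul,
    div_mul_cancel₀ _ hN.ne']
  linarith

lemma klBound_antitone_entropy (hn : 2 ≤ n) {K C δ T H H' : ℝ} {P M : Matrix (Fin n) (Fin n) ℝ}
    {G : SimpleGraph (Fin n)} (h : H ≤ H') :
    klBound K C δ T H' G P M ≤ klBound K C δ T H G P M := by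
  have hn2 : (2 : ℝ) ≤ n := by exact_mod_cast hn
  have hN : 0 ≤ (n : ℝ) * (n - 1) := mul_nonneg (by linarith) (by linarith)
  unfold klBound
  gcongr

end graph

end RDPG

open RDPG in
theorem theorem3p5 :
    ∃ K : ℝ, 0 < K ∧
      ∀ (n : ℕ) (_hn : 2 ≤ n) (C : ℝ) (P : Matrix (Fin n) (Fin n) ℝ) (_hP : P ∈ feasible n)
        (Pstar : SimpleGraph (Fin n) → Matrix (Fin n) (Fin n) ℝ)
        (_hopt : ∀ G, IsOptimal C G (Pstar G)) (δ : ℝ) (_hδ : 0 < δ),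
        1 - δ ≤ (graphLaw P).real
          {A | klDiv P (Pstar A) ≤
                klBound K C δ (∫ G, (Pstar G).trace ∂(graphLaw P)) (entropy P) A P (Pstar A) ∧
               klDiv P (Pstar A) ≤
                klBound K C δ (∫ G, (Pstar G).trace ∂(graphLaw P)) (bernoulliEntropy P) A P
                  (Pstar A)} := by
  refine ⟨256, by norm_num, fun n hn C P hP Pstar hopt δ hδ => ?_⟩
  have hn2 : (2 : ℝ) ≤ n := by exact_mod_cast hn
  have hn0 : (0 : ℝ) < n := by linarith
  have hl := le_log_of_two_le hn
  have hr : 0 < √(n : ℝ) := Real.sqrt_pos.2 hn0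
  have hrr : √(n : ℝ) ^ 2 = n := Real.sq_sqrt hn0.le
  set T := ∫ G, (Pstar G).trace ∂(graphLaw P) with hT
  have hTavg : T = bernoulliAvg (fun e => P e.1 e.2) (upperPairs n)
      (fun s => (Pstar (graphOfPairs s)).trace) := by
    rw [hT, integral_graphLaw hP, sum_graphMass_mul]
  have hT1 : 1 ≤ T := by
    rw [hTavg, ← bernoulliAvg_const (p := fun e : Fin n × Fin n => P e.1 e.2)
      (E := upperPairs n) 1]
    exact bernoulliAvg_mono (apply_mem_unitInterval_of_mem_feasible hP)
      fun s _ => one_le_trace_of_mem_feasible hn (hopt _).1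
  refine one_sub_le_graphLaw_real hP (Y := fun G => max 0 (noise P (edgePairs G) (Pstar G)))
    (t := 256 * T * Real.log n / (δ * √n) * ((n : ℝ) * (n - 1)))
    (fun G => le_max_left _ _) ?_ ?_ ?_
  · have : (0 : ℝ) < n - 1 := by linarith
    positivity
  · have hE := bernoulliAvg_max_noise_le hn hP (fun s => Pstar (graphOfPairs s))
      fun s => (hopt _).1
    rw [← hTavg] at hE
    rw [sum_graphMass_mul]
    have hcongr : bernoulliAvg (fun e => P e.1 e.2) (upperPairs n)
          (fun s => max 0 (noise P (edgePairs (graphOfPairs s)) (Pstar (graphOfPairs s))))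
        = bernoulliAvg (fun e => P e.1 e.2) (upperPairs n)
          (fun s => max 0 (noise P s (Pstar (graphOfPairs s)))) :=
      bernoulliAvg_congr fun s hs => by rw [edgePairs_graphOfPairs hs]
    rw [hcongr]
    refine hE.trans ?_
    -- `n (n - 1) / √n = √n (n - 1)` is at least `n √n / 2`.
    have h1 : δ * (256 * T * Real.log n / (δ * √n) * ((n : ℝ) * (n - 1)))
        = 256 * T * Real.log n * √n * (n - 1) := by
      field_simp
      rw [hrr]
    rw [h1]
    have h2 : 0 ≤ 128 * T * Real.log n * √n * (n - 2) :=
      mul_nonneg (by positivity) (by linarith)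
    linarith
  · intro G hG
    have h := klDiv_le_klBound hn hP (hopt G) ((le_max_right _ _).trans hG)
    exact ⟨h.trans (klBound_antitone_entropy hn (entropy_le_bernoulliEntropy hP)), h⟩
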